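/- Let $X=\{X(t)\}_{t\in\mathbb R}$ be a real, stationary, mean-zero Gaussian process with spectral measure $\rho$, i.e. $\rho$ is a finite Borel measure on $\mathbb R$ with $\mathrm{Cov}[X(t),X(s)]=r(t-s)$ for all $s,t\in\mathbb R$, where $$r(z):=\int_{\mathbb R}e^{-i\lambda z}\,d\rho(\lambda).$$ Suppose that $\int_{\mathbb R}e^{|\lambda|\kappa}\,d\rho(\lambda)<\infty$ for some $\kappa>0$, so that the integral defining $r(z)$ converges for all complex $z$ with $|\mathrm{Im}(z)|<\kappa$. Let $\mathbb S:=\{z\in\mathbb C:|\mathrm{Im}(z)|<\kappa/2\}$. Then, on some probability space, there exists a zero-mean, complex analytic, Gaussian random function $f:\mathbb S\to\mathbb C$ (i.e. its sample paths are analytic on $\mathbb S$ and the real and imaginary parts of its values at finitely many points are jointly Gaussian with mean zero) such that: (a) $f$ is conjugation equivariant: $f(\bar z)=\overline{f(z)}$ for all $z\in\mathbb S$. (b) For all $z,w\in\mathbb S$, $$\mathbb E\big[f(z)\overline{f(w)}\big]=r(z-\bar w),\qquad \mathbb E\big[f(z)f(w)\big]=r(z-w).$$ (c) The law of $z\mapsto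 f(z)$ is stationary under real translations, i.e. $\{f(z+t)\}_{z\in\mathbb S}\stackrel{d}{=}\{f(z)\}_{z\in\mathbb S}$ for every $t\in\mathbb R$, and $\{f(t+i0)\}_{t\in\mathbb R}\stackrel{d}{=}\{X(t)\}_{t\in\mathbb R}$. -/

import Mathlib

open MeasureTheory ProbabilityTheory

noncomputable section

/-- A real, stationary, mean-zero Gaussian process indexed by `ℝ`: its finite-dimensional
distributions are centered multivariate normal, and its law is invariant under real shifts.
The law of a process is its law on the space of all functions with the product σ-algebra,
which carries the same information as the family of finite-dimensional distributions. -/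
structure IsStationaryGaussian {Ω : Type*} [MeasurableSpace Ω]
    (X : ℝ → Ω → ℝ) (P : Measure Ω) : Prop where
  measurable : ∀ t, Measurable (X t)
  gaussian : IsGaussianProcess X P
  centered : ∀ t, ∫ ω, X t ω ∂P = 0
  stationary : ∀ s : ℝ,
    IdentDistrib (fun ω (t : ℝ) => X (t + s) ω) (fun ω (t : ℝ) => X t ω) P P

/-- `covExt ρ z = ∫ exp (-i x z) dρ(x)`: on the real line this is the covariance function with
spectral measure `ρ`, and for complex `z` its analytic extension, wherever the integral
converges. -/
def covExt (ρ : Measure ℝ) (z : ℂ) : ℂ :=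
  ∫ x : ℝ, Complex.exp (-Complex.I * x * z) ∂ρ

/-- The finite measure `ρ` is the spectral measure of the stationary process `X`, whose
covariance function is `r(t) = Cov [X t, X 0]`. -/
structure IsSpectralMeasure {Ω : Type*} [MeasurableSpace Ω]
    (X : ℝ → Ω → ℝ) (P : Measure Ω) (ρ : Measure ℝ) : Prop where
  finite : IsFiniteMeasure ρ
  cov_eq : ∀ t : ℝ, ((cov[X t, X 0; P] : ℝ) : ℂ) = covExt ρ (t : ℂ)

/-- The open horizontal strip `|Im z| < a`. -/
def strip (a : ℝ) : Set ℂ := {z | |z.im| < a}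

/-- A zero-mean Gaussian complex analytic function on `U ⊆ ℂ`: a random function all of whose
sample paths are analytic on `U`, and for which the real and imaginary parts of the values at
finitely many points of `U` are jointly (real) Gaussian with mean zero. The values of `f ω`
outside `U` play no role. -/
structure IsGaussianAnalyticFunction {Ω : Type*} [MeasurableSpace Ω]
    (U : Set ℂ) (f : Ω → ℂ → ℂ) (P : Measure Ω) : Prop where
  measurable : ∀ z ∈ U, Measurable (fun ω => f ω z)
  analytic : ∀ ω, AnalyticOnNhd ℂ (f ω) U
  gaussian : IsGaussianProcess (fun (z : U) ω => f ω z) P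
  centered : ∀ z ∈ U, ∫ ω, f ω z ∂P = 0

end

/-! Formally, `f z = ∫ hartley (x * z) dW(x)`, where `W` is real Gaussian white noise with control
measure `ρ` and `hartley = cos + sin`. The covariance of `X` is real, so `ρ` is symmetric. Since
`hartley a * hartley b = cos (a - b) + sin (a + b)` and odd functions integrate to zero, `E[f z * f
w] = r(z - w)`. The kernel commutes with conjugation, hence so does `f`, and this turns the second
covariance formula into the first. Unlike `exp (-i x z)`, the kernel is real for real `z`, so real
noise suffices.

White noise is replaced by countably many Gaussians. A Taylor expansion of the kernel on each band
`[k, k + 1)` gives `hartley (x * z) = ∑ hartleyCoeff q z * bandPow q x` with `q = (k, j)`. If `η q`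
is a Gaussian family with the Gram matrix of `bandPow q` in `L²(ρ)`, put `f z = ∑ hartleyCoeff q z *
η q`. The coefficients grow like `exp (|k| |Im z|)` and the norms decay like `exp (-|k| κ / 2)`, so
the series converges locally uniformly on the strip (`summable_coeffBound_mul`), and its sum is
analytic.

Everything about laws is read off `HasHartleyLaw`: the real part of a finite complex combination of
values of `f` is a centered Gaussian whose variance is an explicit integral against `ρ`. Such real
parts determine the law of a process (`identDistrib_of_map_re_sum_eq`), so stationarity and the
comparison with `X` become equalities of variances. -/

noncomputable section

/-! ### Gaussian sequences with a prescribed Gram matrix -/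

/-- A vector of a family is recovered from its coordinates along the normalized Gram-Schmidt
vectors. -/
lemma sum_inner_gramSchmidtNormed_smul {H : Type*} [NormedAddCommGroup H] [InnerProductSpace ℝ H]
    (v : ℕ → H) {n M : ℕ} (hn : n < M) :
    ∑ i ∈ Finset.range M, inner ℝ (InnerProductSpace.gramSchmidtNormed ℝ v i) (v n) •
      InnerProductSpace.gramSchmidtNormed ℝ v i = v n := by
  have hz : ∀ i, n < i → inner ℝ (InnerProductSpace.gramSchmidtNormed ℝ v i) (v n) = 0 := by
    intro i hi
    simp [InnerProductSpace.gramSchmidtNormed, inner_smul_left,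
      InnerProductSpace.gramSchmidt_inv_triangular ℝ v hi]
  -- This also covers a vanishing Gram-Schmidt vector: its normalization is zero, and so is the
  -- right-hand side.
  have key : ∀ i, inner ℝ (InnerProductSpace.gramSchmidtNormed ℝ v i) (v n) •
      InnerProductSpace.gramSchmidtNormed ℝ v i =
      (inner ℝ (InnerProductSpace.gramSchmidt ℝ v i) (v n) /
        (‖InnerProductSpace.gramSchmidt ℝ v i‖ : ℝ) ^ 2) • InnerProductSpace.gramSchmidt ℝ v i := by
    intro i
    simp only [InnerProductSpace.gramSchmidtNormed, inner_smul_left, smul_smul]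
    congr 1
    simp
    ring
  rw [← Finset.sum_subset (Finset.range_subset_range.2 (Nat.succ_le_of_lt hn))]
  · rw [Finset.sum_range_succ, key]
    conv_rhs => rw [InnerProductSpace.gramSchmidt_def'' ℝ v n]
    rw [add_comm]
    congr 1
    · by_cases h0 : InnerProductSpace.gramSchmidt ℝ v n = 0
      · simp [h0]
      have : inner ℝ (InnerProductSpace.gramSchmidt ℝ v n) (v n)
          = ‖InnerProductSpace.gramSchmidt ℝ v n‖ ^ 2 := by
        conv_lhs => rw [InnerProductSpace.gramSchmidt_def'' ℝ v n]
        rw [inner_add_right, inner_sum, Finset.sum_eq_zero, add_zero, real_inner_self_eq_norm_sq]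
        intro i hi
        rw [inner_smul_right, InnerProductSpace.gramSchmidt_orthogonal ℝ v
          (Finset.mem_Iio.1 hi).ne', mul_zero]
      rw [this, div_self (by simpa using h0), one_smul]
    · have : Finset.Iio n = Finset.range n := by ext; simp
      rw [this]
      exact Finset.sum_congr rfl fun i _ => by rw [key]; rfl
  · intro i _ hi
    rw [hz i (by simpa using hi), zero_smul]

/-- Parseval's identity for linear combinations of the first `M` vectors of a family. -/
lemma sum_sq_inner_gramSchmidtNormed {H : Type*} [NormedAddCommGroup H] [InnerProductSpace ℝ H]
    (v : ℕ → H) (b : ℕ → ℝ) {F : Finset ℕ} {M : ℕ} (hF : ∀ n ∈ F, n < M) :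
    ∑ i ∈ Finset.range M,
      (inner ℝ (InnerProductSpace.gramSchmidtNormed ℝ v i) (∑ n ∈ F, b n • v n)) ^ 2 =
      ‖∑ n ∈ F, b n • v n‖ ^ 2 := by
  set s := ∑ n ∈ F, b n • v n with hs
  have h1 : ∑ i ∈ Finset.range M, inner ℝ (InnerProductSpace.gramSchmidtNormed ℝ v i) s •
      InnerProductSpace.gramSchmidtNormed ℝ v i = s := by
    simp only [hs, inner_sum, inner_smul_right, Finset.sum_smul]
    rw [Finset.sum_comm]
    refine Finset.sum_congr rfl fun n hn => ?_
    simp only [mul_smul]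
    rw [← Finset.smul_sum, sum_inner_gramSchmidtNormed_smul v (hF n hn)]
  rw [← real_inner_self_eq_norm_sq]
  conv_rhs => enter [2]; rw [← h1]
  rw [sum_inner]
  refine Finset.sum_congr rfl fun i _ => ?_
  rw [inner_smul_left, sq]
  rfl

/-- For every sequence of vectors in a real inner product space there is a sequence of jointly
Gaussian centered random variables with the same Gram matrix. -/
theorem exists_gaussian_sequence {H : Type*} [NormedAddCommGroup H] [InnerProductSpace ℝ H]
    (v : ℕ → H) :
    ∃ (Ω : Type) (_ : MeasurableSpace Ω) (P : Measure Ω) (_ : IsProbabilityMeasure P)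
      (η : ℕ → Ω → ℝ), (∀ n, Measurable (η n)) ∧
      ∀ (F : Finset ℕ) (b : ℕ → ℝ),
        P.map (fun ω => ∑ n ∈ F, b n * η n ω) = gaussianReal 0 (‖∑ n ∈ F, b n • v n‖₊ ^ 2) := by
  let P : Measure (ℕ → ℝ) := Measure.infinitePi fun _ => gaussianReal 0 1
  let e := InnerProductSpace.gramSchmidtNormed ℝ v
  -- Each `v n` is replaced by its coordinates along `e`, paired with independent standard
  -- Gaussians. Indices `i > n` are not needed, because `v n` lies in the span of the first `n + 1`
  -- vectors.
  refine ⟨ℕ → ℝ, inferInstance, P, inferInstance,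
    fun n ω => ∑ i ∈ Finset.range (n + 1), inner ℝ (e i) (v n) * ω i, fun n => by fun_prop, ?_⟩
  intro F b
  have hlaw : ∀ i, P.map (fun ω => ω i) = gaussianReal 0 1 := fun i => by
    simpa [P] using Measure.infinitePi_map_eval (fun _ : ℕ => gaussianReal 0 1) i
  have hG : ∀ i, HasGaussianLaw (fun ω : ℕ → ℝ => ω i) P := fun i =>
    ⟨by rw [hlaw]; infer_instance⟩
  have hind : iIndepFun (fun i (ω : ℕ → ℝ) => ω i) P :=
    iIndepFun_infinitePi (P := fun _ : ℕ => gaussianReal 0 1) (X := fun _ x => x)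
      fun _ => measurable_id
  obtain ⟨M, hM⟩ : ∃ M, ∀ n ∈ F, n < M := ⟨F.sup id + 1, fun n hn =>
    Nat.lt_succ_of_le (Finset.le_sup (f := id) hn)⟩
  have heq : (fun ω : ℕ → ℝ => ∑ n ∈ F, b n * ∑ i ∈ Finset.range (n + 1), inner ℝ (e i) (v n) * ω i)
      = fun ω => ∑ i ∈ Finset.range M, inner ℝ (e i) (∑ n ∈ F, b n • v n) * ω i := by
    funext ω
    simp only [inner_sum, inner_smul_right, Finset.sum_mul]
    rw [Finset.sum_comm]
    refine Finset.sum_congr rfl fun n hn => ?_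
    rw [Finset.mul_sum, Finset.sum_subset (Finset.range_subset_range.2 (Nat.succ_le_of_lt (hM n hn)))]
    · exact Finset.sum_congr rfl fun i _ => by ring
    · intro i _ hi
      have : inner ℝ (e i) (v n) = 0 := by
        simp [e, InnerProductSpace.gramSchmidtNormed, inner_smul_left,
          InnerProductSpace.gramSchmidt_inv_triangular ℝ v (show n < i by simpa using hi)]
      simp [this]
  rw [heq]
  set d : ℕ → ℝ := fun i => inner ℝ (e i) (∑ n ∈ F, b n • v n) with hd
  have hproc : IsGaussianProcess (fun i (ω : ℕ → ℝ) => ω i) P := ⟨fun I =>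
    iIndepFun.hasGaussianLaw (X := fun (i : I) (ω : ℕ → ℝ) => ω i) (fun i => hG i)
      (hind.precomp Subtype.val_injective)⟩
  have hsum : HasGaussianLaw (fun ω : ℕ → ℝ => ∑ i ∈ Finset.range M, d i * ω i) P :=
    (hproc.smul d).hasGaussianLaw_fun_sum
  have hmean : ∀ i, ∫ ω, ω i ∂P = 0 := fun i => by
    have := integral_map (μ := P) (φ := fun ω : ℕ → ℝ => ω i) (f := id)
      (measurable_pi_apply i).aemeasurable (by fun_prop)
    rw [hlaw] at this
    simpa [integral_id_gaussianReal] using this.symm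
  have hvar : ∀ i, Var[fun ω : ℕ → ℝ => ω i; P] = 1 := fun i => by
    have := variance_map (μ := P) (Y := fun ω : ℕ → ℝ => ω i) (X := id) (by fun_prop)
      (measurable_pi_apply i).aemeasurable
    rw [hlaw, variance_id_gaussianReal] at this
    simpa using this.symm
  rw [hsum.map_eq_gaussianReal]
  congr 1
  · rw [integral_finsetSum _ fun i _ => ((hG i).integrable.const_mul _)]
    simp [integral_const_mul, hmean]
  · have : Var[fun ω : ℕ → ℝ => ∑ i ∈ Finset.range M, d i * ω i; P]
        = ∑ i ∈ Finset.range M, d i ^ 2 := by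
      have h := IndepFun.variance_sum (μ := P) (X := fun i (ω : ℕ → ℝ) => d i * ω i)
        (s := Finset.range M) (fun i _ => (hG i).memLp_two.const_mul _)
        (fun i _ j _ hij => (hind.indepFun hij).comp (measurable_const_mul (d i))
          (measurable_const_mul (d j)))
      have h2 : (fun ω : ℕ → ℝ => ∑ i ∈ Finset.range M, d i * ω i)
        = ∑ i ∈ Finset.range M, fun ω : ℕ → ℝ => d i * ω i := by ext; simp
      rw [h2, h]
      refine Finset.sum_congr rfl fun i _ => ?_
      rw [variance_const_mul, hvar, mul_one]
    rw [this, hd, sum_sq_inner_gramSchmidtNormed v b hM]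
    ext
    simp

/-! ### Convergent Gaussian series -/

lemma integral_sq_of_map_eq_gaussianReal {Ω : Type*} [MeasurableSpace Ω] {P : Measure Ω}
    {Y : Ω → ℝ} (hY : Measurable Y) {s : NNReal} (h : P.map Y = gaussianReal 0 s) :
    MemLp Y 2 P ∧ ∫ ω, Y ω ∂P = 0 ∧ ∫ ω, Y ω ^ 2 ∂P = s := by
  have hm : MemLp Y 2 P := by
    have := memLp_id_gaussianReal (μ := 0) (v := s) 2
    rw [← h, memLp_map_measure_iff (by fun_prop) hY.aemeasurable] at this
    exact this
  have h1 : ∫ ω, Y ω ∂P = 0 := by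
    have := integral_map (μ := P) (φ := Y) (f := id) hY.aemeasurable (by fun_prop)
    rw [h] at this
    simpa [integral_id_gaussianReal] using this.symm
  refine ⟨hm, h1, ?_⟩
  have hv := variance_map (μ := P) (Y := Y) (X := id) (by fun_prop) hY.aemeasurable
  rw [h, variance_id_gaussianReal] at hv
  rw [hv, Function.id_comp, variance_of_integral_eq_zero hY.aemeasurable h1]

lemma eLpNorm_two_of_map_eq_gaussianReal {Ω : Type*} [MeasurableSpace Ω] {P : Measure Ω}
    {Y : Ω → ℝ} (hY : Measurable Y) {s : NNReal} (h : P.map Y = gaussianReal 0 (s ^ 2)) :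
    eLpNorm Y 2 P = s := by
  obtain ⟨hm, -, h2⟩ := integral_sq_of_map_eq_gaussianReal hY h
  rw [hm.eLpNorm_eq_integral_rpow_norm (by norm_num) (by norm_num)]
  simp only [ENNReal.toReal_ofNat, Real.rpow_two, Real.norm_eq_abs, sq_abs, h2]
  rw [show ((2 : ℝ)⁻¹) = 1 / 2 by norm_num, ← Real.sqrt_eq_rpow]
  simp

/-- A jointly Gaussian centered family with prescribed Gram matrix, along which prescribed
absolutely convergent series converge at every sample point. -/
theorem exists_gaussian_family_summable {ι : Type*} [Denumerable ι]
    {H : Type*} [NormedAddCommGroup H] [InnerProductSpace ℝ H]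
    (v : ι → H) (u : ℕ → ι → ℝ) (hu0 : ∀ k i, 0 ≤ u k i)
    (hu : ∀ k, Summable fun i => u k i * ‖v i‖) :
    ∃ (Ω : Type) (_ : MeasurableSpace Ω) (P : Measure Ω) (_ : IsProbabilityMeasure P)
      (η : ι → Ω → ℝ), (∀ i, Measurable (η i)) ∧
      (∀ (F : Finset ι) (b : ι → ℝ),
        P.map (fun ω => ∑ i ∈ F, b i * η i ω) = gaussianReal 0 (‖∑ i ∈ F, b i • v i‖₊ ^ 2)) ∧
      ∀ ω k, Summable fun i => u k i * |η i ω| := by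
  obtain ⟨Ω, mΩ, P, hP, ζ, hζ, hlaw⟩ :=
    exists_gaussian_sequence fun n => v ((Denumerable.eqv ι).symm n)
  let e := Denumerable.eqv ι
  let η : ι → Ω → ℝ := fun i => ζ (e i)
  have hη : ∀ i, Measurable (η i) := fun i => hζ _
  have hlawη : ∀ (F : Finset ι) (b : ι → ℝ),
      P.map (fun ω => ∑ i ∈ F, b i * η i ω) = gaussianReal 0 (‖∑ i ∈ F, b i • v i‖₊ ^ 2) := by
    intro F b
    have := hlaw (F.map e.toEmbedding) fun n => b (e.symm n)
    simpa [Finset.sum_map, η, e] using this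
  -- The `L²` norms of the terms are `u k i * ‖v i‖`, which are summable; this forces almost sure
  -- absolute convergence.
  have hae : ∀ᵐ ω ∂P, ∀ k, Summable fun i => u k i * |η i ω| := by
    refine ae_all_iff.2 fun k => ?_
    have h := summable_norm_of_tsum_eLpNorm_ne_top (μ := P) (p := 2) (by norm_num)
      (f := fun i ω => u k i * η i ω) (fun i => ((hη i).const_mul _).aestronglyMeasurable) ?_
    · filter_upwards [h] with ω hω
      simpa [abs_mul, abs_of_nonneg (hu0 k _)] using hω
    · have : ∀ i, eLpNorm (fun ω => u k i * η i ω) 2 P = ‖u k i * ‖v i‖‖ₑ := by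
        intro i
        have h1 : P.map (fun ω => u k i * η i ω) = gaussianReal 0 ((‖u k i‖₊ * ‖v i‖₊) ^ 2) := by
          have := hlawη {i} (u k)
          simpa [nnnorm_smul] using this
        rw [eLpNorm_two_of_map_eq_gaussianReal ((hη i).const_mul _) h1, enorm_mul, enorm_norm]
        simp [enorm_eq_nnnorm]
      simp only [this]
      exact tsum_enorm_ne_top_iff_summable_norm.2 (hu k).norm
  -- All variables are set to zero on a measurable null set containing the bad sample points:
  -- convergence becomes sure and the laws do not change.
  obtain ⟨G, hGsub, hGm, hG0⟩ := exists_measurable_superset_of_null hae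
  let S := Gᶜ
  have hS : ∀ᵐ ω ∂P, ω ∈ S := by rw [ae_iff]; simpa [S] using hG0
  refine ⟨Ω, mΩ, P, hP, fun i => S.indicator (η i), fun i => (hη i).indicator hGm.compl, ?_, ?_⟩
  · intro F b
    rw [← hlawη F b]
    refine Measure.map_congr ?_
    filter_upwards [hS] with ω hω
    simp [Set.indicator_of_mem hω]
  · intro ω k
    by_cases hω : ω ∈ S
    · have : ∀ k, Summable fun i => u k i * |η i ω| := by
        by_contra hcon
        exact hω (hGsub hcon)
      simpa [Set.indicator_of_mem hω] using this k
    · simp [Set.indicator_of_notMem hω, summable_zero]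

/-- An infinite linear combination of a Gaussian family is Gaussian, its variance being the squared
norm of the corresponding combination in `L²`. -/
theorem map_eq_gaussianReal_of_hasSum {Ω α ι : Type*} [Countable ι] [MeasurableSpace Ω]
    [MeasurableSpace α] {P : Measure Ω} [IsProbabilityMeasure P] {ρ : Measure α}
    {v : ι → Lp ℝ 2 ρ} {η : ι → Ω → ℝ} (hη : ∀ i, Measurable (η i))
    (hlaw : ∀ (F : Finset ι) (b : ι → ℝ),
      P.map (fun ω => ∑ i ∈ F, b i * η i ω) = gaussianReal 0 (‖∑ i ∈ F, b i • v i‖₊ ^ 2))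
    {b : ι → ℝ} (hb : Summable fun i => |b i| * ‖v i‖)
    {Y : Ω → ℝ} (hY : ∀ ω, HasSum (fun i => b i * η i ω) (Y ω))
    {g : α → ℝ} (hg : ∀ᵐ x ∂ρ, HasSum (fun i => b i * v i x) (g x)) :
    Measurable Y ∧ MemLp g 2 ρ ∧ P.map Y = gaussianReal 0 (∫ x, g x ^ 2 ∂ρ).toNNReal := by
  have hYm : Measurable Y :=
    measurable_of_tendsto_metrizable' (Filter.atTop : Filter (Finset ι))
      (f := fun F ω => ∑ i ∈ F, b i * η i ω)
      (fun F => Finset.measurable_sum _ fun i _ => (hη i).const_mul _)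
      (tendsto_pi_nhds.2 fun ω => hY ω)
  have hsum : Summable fun i => b i • v i := by
    refine Summable.of_norm ?_
    simpa [norm_smul] using hb
  have hlim := Lp.hasSum_coeFn_tsum (f := fun i => b i • v i) (by
    rw [tsum_enorm_ne_top_iff_summable_norm]
    simpa [norm_smul] using hb)
  set s : Lp ℝ 2 ρ := ∑' i, b i • v i with hs
  have hgs : g =ᵐ[ρ] s := by
    have hc : ∀ᵐ x ∂ρ, ∀ i, (b i • v i : Lp ℝ 2 ρ) x = b i * v i x :=
      ae_all_iff.2 fun i => Lp.coeFn_smul (b i) (v i)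
    filter_upwards [hg, hlim, hc] with x h1 h2 h3
    simp only [h3] at h2
    exact h1.unique h2
  have hgm : MemLp g 2 ρ := (memLp_congr_ae hgs).2 (Lp.memLp s)
  have hgn : ∫ x, g x ^ 2 ∂ρ = ‖s‖ ^ 2 := by
    rw [← real_inner_self_eq_norm_sq, L2.inner_def]
    refine integral_congr_ae ?_
    filter_upwards [hgs] with x hx
    simp [hx, sq]
  refine ⟨hYm, hgm, ?_⟩
  have : IsProbabilityMeasure (P.map Y) := Measure.isProbabilityMeasure_map hYm.aemeasurable
  apply Measure.ext_of_charFun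
  ext t
  rw [charFun_gaussianReal]
  -- The characteristic functions of the partial sums have two limits: dominated convergence gives
  -- that of `Y`, and continuity of the variance in the `L²` vector gives the Gaussian one.
  have h1 : Filter.Tendsto (fun F : Finset ι =>
      charFun (P.map (fun ω => ∑ i ∈ F, b i * η i ω)) t) Filter.atTop
      (nhds (charFun (P.map Y) t)) := by
    simp only [charFun_apply_real]
    have hF : ∀ F : Finset ι, Measurable fun ω => ∑ i ∈ F, b i * η i ω :=
      fun F => Finset.measurable_sum _ fun i _ => (hη i).const_mul _
    rw [integral_map hYm.aemeasurable (by fun_prop)]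
    simp_rw [fun F => integral_map (μ := P) (hF F).aemeasurable
      (f := fun x : ℝ => Complex.exp (t * x * Complex.I)) (by fun_prop)]
    refine tendsto_integral_filter_of_dominated_convergence (fun _ => 1)
      (Filter.Eventually.of_forall fun F => ?_) (Filter.Eventually.of_forall fun F => ?_)
      (integrable_const _) ?_
    · have := hF F
      exact Measurable.aestronglyMeasurable (by fun_prop)
    · refine Filter.Eventually.of_forall fun ω => ?_
      rw [← Complex.ofReal_mul, Complex.norm_exp_ofReal_mul_I]
    · refine Filter.Eventually.of_forall fun ω => ?_
      have hc : Continuous fun x : ℝ => Complex.exp (t * x * Complex.I) := by fun_prop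
      exact (hc.tendsto _).comp (hY ω)
  have h2 : Filter.Tendsto (fun F : Finset ι =>
      charFun (P.map (fun ω => ∑ i ∈ F, b i * η i ω)) t) Filter.atTop
      (nhds (Complex.exp (t * (0 : ℝ) * Complex.I - (‖s‖ ^ 2 : ℝ) * t ^ 2 / 2))) := by
    simp only [hlaw, charFun_gaussianReal]
    have hc : Continuous fun x : Lp ℝ 2 ρ =>
        Complex.exp (t * (0 : ℝ) * Complex.I - (‖x‖ ^ 2 : ℝ) * t ^ 2 / 2) := by fun_prop
    have := (hc.tendsto s).comp hsum.hasSum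
    simpa [Function.comp_def] using this
  rw [tendsto_nhds_unique h1 h2, hgn, Real.coe_toNNReal _ (by positivity)]

/-! ### The Hartley kernel and its expansion over unit bands -/

/-- The Hartley kernel `cos + sin`. -/
def hartley (w : ℂ) : ℂ := Complex.cos w + Complex.sin w

lemma hartley_eq_exp (w : ℂ) :
    hartley w = (1 - Complex.I) / 2 * Complex.exp (Complex.I * w) +
      (1 + Complex.I) / 2 * Complex.exp (-Complex.I * w) := by
  rw [hartley, Complex.cos, Complex.sin]
  rw [mul_comm Complex.I w, show -Complex.I * w = -w * Complex.I by ring]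
  ring

lemma norm_one_sub_I_div_two_le : ‖(1 - Complex.I) / 2‖ ≤ 1 := by
  refine (norm_div _ _).trans_le ?_
  have := norm_sub_le (1 : ℂ) Complex.I
  norm_num at this ⊢
  linarith

lemma norm_one_add_I_div_two_le : ‖(1 + Complex.I) / 2‖ ≤ 1 := by
  refine (norm_div _ _).trans_le ?_
  have := norm_add_le (1 : ℂ) Complex.I
  norm_num at this ⊢
  linarith

lemma norm_exp_I_mul_ofReal_mul_le (x : ℝ) (z : ℂ) :
    ‖Complex.exp (Complex.I * (x * z))‖ ≤ Real.exp (|x| * |z.im|) := by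
  rw [Complex.norm_exp, Real.exp_le_exp, ← abs_mul]
  have : (Complex.I * (x * z)).re = -(x * z.im) := by simp
  rw [this]
  exact neg_le_abs _

lemma norm_exp_neg_I_mul_ofReal_mul_le (x : ℝ) (z : ℂ) :
    ‖Complex.exp (-Complex.I * (x * z))‖ ≤ Real.exp (|x| * |z.im|) := by
  have := norm_exp_I_mul_ofReal_mul_le x (-z)
  simpa using this

lemma norm_hartley_le (x : ℝ) (z : ℂ) : ‖hartley (x * z)‖ ≤ 2 * Real.exp (|x| * |z.im|) := by
  rw [hartley_eq_exp, two_mul]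
  refine (norm_add_le _ _).trans (add_le_add ?_ ?_) <;> rw [norm_mul]
  · exact (mul_le_of_le_one_left (norm_nonneg _) norm_one_sub_I_div_two_le).trans
      (norm_exp_I_mul_ofReal_mul_le x z)
  · exact (mul_le_of_le_one_left (norm_nonneg _) norm_one_add_I_div_two_le).trans
      (norm_exp_neg_I_mul_ofReal_mul_le x z)

/-- The coefficient of `(x - k) ^ j` in the Taylor expansion of `x ↦ hartley (x * z)` at `k`. -/
def hartleyCoeff (q : ℤ × ℕ) (z : ℂ) : ℂ :=
  (1 - Complex.I) / 2 * ((Complex.I * z) ^ q.2 / (q.2.factorial : ℂ) *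
      Complex.exp (Complex.I * (((q.1 : ℝ) : ℂ) * z))) +
    (1 + Complex.I) / 2 * ((-Complex.I * z) ^ q.2 / (q.2.factorial : ℂ) *
      Complex.exp (-Complex.I * (((q.1 : ℝ) : ℂ) * z)))

lemma hartleyCoeff_conj (q : ℤ × ℕ) (z : ℂ) :
    hartleyCoeff q (starRingEnd ℂ z) = starRingEnd ℂ (hartleyCoeff q z) := by
  simp only [hartleyCoeff, map_add, map_mul, map_div₀, map_sub, map_one, map_pow, map_natCast,
    Complex.conj_I, ← Complex.exp_conj, map_neg, Complex.conj_ofReal, Complex.conj_ofNat]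
  ring_nf

lemma differentiable_hartleyCoeff (q : ℤ × ℕ) : Differentiable ℂ (hartleyCoeff q) := by
  unfold hartleyCoeff
  fun_prop

lemma norm_hartleyCoeff_le (q : ℤ × ℕ) {z : ℂ} {R b : ℝ} (hR : ‖z‖ ≤ R) (hb : |z.im| ≤ b) :
    ‖hartleyCoeff q z‖ ≤ R ^ q.2 / (q.2.factorial : ℝ) * (2 * Real.exp (|(q.1 : ℝ)| * b)) := by
  have hexp : Real.exp (|(q.1 : ℝ)| * |z.im|) ≤ Real.exp (|(q.1 : ℝ)| * b) := by gcongr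
  have h1 := (norm_exp_I_mul_ofReal_mul_le (q.1 : ℝ) z).trans hexp
  have h2 := (norm_exp_neg_I_mul_ofReal_mul_le (q.1 : ℝ) z).trans hexp
  have hR0 : 0 ≤ R := (norm_nonneg z).trans hR
  rw [show R ^ q.2 / (q.2.factorial : ℝ) * (2 * Real.exp (|(q.1 : ℝ)| * b)) =
    R ^ q.2 / (q.2.factorial : ℝ) * Real.exp (|(q.1 : ℝ)| * b) +
    R ^ q.2 / (q.2.factorial : ℝ) * Real.exp (|(q.1 : ℝ)| * b) by ring, hartleyCoeff]
  refine (norm_add_le _ _).trans (add_le_add ?_ ?_) <;> rw [norm_mul]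
  · refine (mul_le_of_le_one_left (norm_nonneg _) norm_one_sub_I_div_two_le).trans ?_
    rw [norm_mul, norm_div, norm_pow, norm_mul, Complex.norm_I, one_mul, Complex.norm_natCast]
    gcongr
  · refine (mul_le_of_le_one_left (norm_nonneg _) norm_one_add_I_div_two_le).trans ?_
    rw [norm_mul, norm_div, norm_pow, norm_mul, norm_neg, Complex.norm_I, one_mul,
      Complex.norm_natCast]
    gcongr

/-- The function `(x - k) ^ j` cut off to `[k, k + 1)`. -/
def bandPow (q : ℤ × ℕ) (x : ℝ) : ℝ := if ⌊x⌋ = q.1 then (x - q.1) ^ q.2 else 0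

lemma measurable_bandPow (q : ℤ × ℕ) : Measurable (bandPow q) := by
  unfold bandPow
  exact Measurable.ite (Int.measurable_floor (measurableSet_singleton _)) (by fun_prop)
    measurable_const

lemma bandPow_nonneg (q : ℤ × ℕ) (x : ℝ) : 0 ≤ bandPow q x := by
  unfold bandPow
  split_ifs with h
  · rw [← h]; exact pow_nonneg (sub_nonneg.2 (Int.floor_le x)) _
  · exact le_rfl

lemma bandPow_le_one (q : ℤ × ℕ) (x : ℝ) : bandPow q x ≤ 1 := by
  unfold bandPow
  split_ifs with h
  · rw [← h]
    exact pow_le_one₀ (sub_nonneg.2 (Int.floor_le x)) (by linarith [Int.lt_floor_add_one x])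
  · norm_num

/-- On the band of index `k` one has `|k| ≤ |x| + 1`, which makes the total exponent nonnegative. -/
lemma bandPow_sq_le (q : ℤ × ℕ) {κ : ℝ} (hκ : 0 < κ) (x : ℝ) :
    bandPow q x ^ 2 ≤ Real.exp κ * Real.exp (-(|(q.1 : ℝ)| * κ)) * Real.exp (|x| * κ) := by
  by_cases h : ⌊x⌋ = q.1
  · refine (pow_le_one₀ (bandPow_nonneg q x) (bandPow_le_one q x)).trans ?_
    rw [← Real.exp_add, ← Real.exp_add]
    apply Real.one_le_exp
    have h1 := Int.floor_le x
    have h2 := Int.lt_floor_add_one x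
    rw [h] at h1 h2
    have h3 : |(q.1 : ℝ)| ≤ |x| + 1 := by
      rcases abs_cases (q.1 : ℝ) with h | h <;> rcases abs_cases x with h' | h' <;> linarith
    nlinarith
  · rw [bandPow, if_neg h, zero_pow two_ne_zero]
    positivity

lemma memLp_bandPow (ρ : Measure ℝ) [IsFiniteMeasure ρ] (q : ℤ × ℕ) : MemLp (bandPow q) 2 ρ :=
  MemLp.of_bound (measurable_bandPow q).aestronglyMeasurable 1 <| Filter.Eventually.of_forall
    fun x => by
      rw [Real.norm_eq_abs, abs_of_nonneg (bandPow_nonneg q x)]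
      exact bandPow_le_one q x

/-- The function `bandPow q` as an element of `L²`. -/
def bandLp (ρ : Measure ℝ) [IsFiniteMeasure ρ] (q : ℤ × ℕ) : Lp ℝ 2 ρ :=
  (memLp_bandPow ρ q).toLp (bandPow q)

lemma coeFn_bandLp (ρ : Measure ℝ) [IsFiniteMeasure ρ] (q : ℤ × ℕ) :
    bandLp ρ q =ᵐ[ρ] bandPow q :=
  (memLp_bandPow ρ q).coeFn_toLp

/-- A Chebyshev bound: the exponential moment of order `κ` controls the squared norm, and the square
root halves the rate. This is where the half-width `κ / 2` comes from. -/
lemma norm_bandLp_le {ρ : Measure ℝ} [IsFiniteMeasure ρ] {κ : ℝ} (hκ : 0 < κ)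
    (hexp : Integrable (fun x : ℝ => Real.exp (|x| * κ)) ρ) (q : ℤ × ℕ) :
    ‖bandLp ρ q‖ ≤
      √(Real.exp κ * ∫ x, Real.exp (|x| * κ) ∂ρ) * Real.exp (-(|(q.1 : ℝ)| * (κ / 2))) := by
  refine le_of_sq_le_sq ?_ (by positivity)
  have h0 : 0 ≤ ∫ x, Real.exp (|x| * κ) ∂ρ := integral_nonneg fun x => by positivity
  rw [mul_pow, Real.sq_sqrt (by positivity), ← Real.exp_nat_mul,
    ← real_inner_self_eq_norm_sq, L2.inner_def]
  have : ∫ x, inner ℝ (bandLp ρ q x) (bandLp ρ q x) ∂ρ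
      = ∫ x, bandPow q x ^ 2 ∂ρ := by
    refine integral_congr_ae ?_
    filter_upwards [coeFn_bandLp ρ q] with x hx
    simp [hx, sq]
  rw [this]
  calc ∫ x, bandPow q x ^ 2 ∂ρ
      ≤ ∫ x, Real.exp κ * Real.exp (-(|(q.1 : ℝ)| * κ)) * Real.exp (|x| * κ) ∂ρ :=
        integral_mono_of_nonneg (Filter.Eventually.of_forall fun x => sq_nonneg _)
          (hexp.const_mul _) (Filter.Eventually.of_forall fun x => bandPow_sq_le q hκ x)
    _ = _ := by
      rw [integral_const_mul]
      push_cast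
      rw [show (2 : ℝ) * -(|(q.1 : ℝ)| * (κ / 2)) = -(|(q.1 : ℝ)| * κ) by ring]
      ring

/-- For fixed `x` only the band `k = ⌊x⌋` contributes, and there the sum is the exponential series
in `x - ⌊x⌋`. -/
lemma hasSum_hartleyCoeff (x : ℝ) (z : ℂ) :
    HasSum (fun q => hartleyCoeff q z * (bandPow q x : ℂ)) (hartley (x * z)) := by
  let i : ℕ → ℤ × ℕ := fun j => (⌊x⌋, j)
  have hi : Function.Injective i := fun a b h => (Prod.mk.inj h).2
  rw [← hi.hasSum_iff]
  · have hsum : ∀ w : ℂ, HasSum (fun j : ℕ => w ^ j / (j.factorial : ℂ)) (Complex.exp w) := by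
      intro w
      rw [Complex.exp_eq_exp_ℂ]
      exact NormedSpace.expSeries_div_hasSum_exp w
    have e1 : Complex.exp (Complex.I * (x * z)) = Complex.exp (Complex.I * z * (x - ⌊x⌋)) *
        Complex.exp (Complex.I * (((⌊x⌋ : ℝ) : ℂ) * z)) := by
      rw [← Complex.exp_add]; push_cast; ring_nf
    have e2 : Complex.exp (-Complex.I * (x * z)) = Complex.exp (-Complex.I * z * (x - ⌊x⌋)) *
        Complex.exp (-Complex.I * (((⌊x⌋ : ℝ) : ℂ) * z)) := by
      rw [← Complex.exp_add]; push_cast; ring_nf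
    rw [hartley_eq_exp, e1, e2]
    refine ((((hsum _).mul_right _).mul_left _).add (((hsum _).mul_right _).mul_left _)).congr_fun ?_
    intro j
    simp only [Function.comp_apply, i, hartleyCoeff, bandPow, if_true, mul_pow]
    push_cast
    ring
  · rintro ⟨k, j⟩ h
    have : ⌊x⌋ ≠ k := fun hk => h ⟨j, by simp [i, hk]⟩
    simp [bandPow, this]

/-- Bounds for the coefficients on the part `‖z‖ ≤ n + 1`, `|Im z| ≤ κ / 2 - 1 / (n + 1)` of the
strip of half-width `κ / 2`. -/
def coeffBound (κ : ℝ) (n : ℕ) (q : ℤ × ℕ) : ℝ :=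
  ((n : ℝ) + 1) ^ q.2 / (q.2.factorial : ℝ) *
    (2 * Real.exp (|(q.1 : ℝ)| * (κ / 2 - 1 / ((n : ℝ) + 1))))

/-- The rates `κ / 2 - 1 / (n + 1)` and `-κ / 2` add up to `-1 / (n + 1)`, so the bound is a
geometric series in `|k|` times an exponential series in `j`. -/
lemma summable_coeffBound_mul {ρ : Measure ℝ} [IsFiniteMeasure ρ] {κ : ℝ} (hκ : 0 < κ)
    (hexp : Integrable (fun x : ℝ => Real.exp (|x| * κ)) ρ) (n : ℕ) :
    Summable fun q => coeffBound κ n q * ‖bandLp ρ q‖ := by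
  set C := √(Real.exp κ * ∫ x, Real.exp (|x| * κ) ∂ρ)
  have hn : (0 : ℝ) < 1 / ((n : ℝ) + 1) := by positivity
  have h1 : Summable fun k : ℤ => 2 * C * Real.exp (|(k : ℝ)| * (-(1 / ((n : ℝ) + 1)))) := by
    refine Summable.mul_left _ ?_
    have hN : Summable fun m : ℕ => Real.exp ((m : ℝ) * (-(1 / ((n : ℝ) + 1)))) :=
      Real.summable_exp_nat_mul_iff.2 (by linarith)
    refine Summable.of_nat_of_neg ?_ ?_
    · simpa using hN
    · simpa using hN
  have h2 : Summable fun j : ℕ => ((n : ℝ) + 1) ^ j / (j.factorial : ℝ) :=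
    Real.summable_pow_div_factorial _
  refine Summable.of_nonneg_of_le (fun q => ?_) (fun q => ?_)
    (h1.mul_of_nonneg h2 (fun k => by positivity) (fun j => by positivity))
  · unfold coeffBound; positivity
  · have h3 := norm_bandLp_le hκ hexp q
    have h4 : 0 ≤ coeffBound κ n q := by unfold coeffBound; positivity
    refine (mul_le_mul_of_nonneg_left h3 h4).trans (le_of_eq ?_)
    rw [coeffBound, show |(q.1 : ℝ)| * (-(1 / ((n : ℝ) + 1))) =
      |(q.1 : ℝ)| * (κ / 2 - 1 / ((n : ℝ) + 1)) + -(|(q.1 : ℝ)| * (κ / 2)) by ring, Real.exp_add]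
    ring

/-! ### Construction of the analytic function -/

/-- The law of the real linear functionals of a random function which formally is the integral of
the Hartley kernel against Gaussian white noise with control measure `ρ`. -/
def HasHartleyLaw {Ω : Type*} [MeasurableSpace Ω] (ρ : Measure ℝ) (U : Set ℂ) (f : Ω → ℂ → ℂ)
    (P : Measure Ω) : Prop :=
  ∀ {T : Type} [Fintype T] (p c : T → ℂ), (∀ t, p t ∈ U) →
    Measurable (fun ω => (∑ t, c t * f ω (p t)).re) ∧
    MemLp (fun x : ℝ => (∑ t, c t * hartley (x * p t)).re) 2 ρ ∧
    P.map (fun ω => (∑ t, c t * f ω (p t)).re) =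
      gaussianReal 0 (∫ x : ℝ, (∑ t, c t * hartley (x * p t)).re ^ 2 ∂ρ).toNNReal

lemma isOpen_strip (a : ℝ) : IsOpen (strip a) :=
  isOpen_lt (Complex.continuous_im.abs) continuous_const

lemma exists_nat_bound_of_mem_strip {a : ℝ} {z : ℂ} (hz : z ∈ strip a) :
    ∃ n : ℕ, ‖z‖ < (n : ℝ) + 1 ∧ |z.im| < a - 1 / ((n : ℝ) + 1) := by
  obtain ⟨n, hn⟩ := exists_nat_gt (max ‖z‖ (1 / (a - |z.im|)))
  have hpos : 0 < a - |z.im| := sub_pos.2 hz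
  refine ⟨n, by linarith [le_max_left ‖z‖ (1 / (a - |z.im|))], ?_⟩
  have h : 1 / (a - |z.im|) < (n : ℝ) + 1 := by linarith [le_max_right ‖z‖ (1 / (a - |z.im|))]
  have := one_div_lt_one_div_of_lt (one_div_pos.2 hpos) h
  rw [one_div_one_div] at this
  linarith

theorem exists_analytic_hasHartleyLaw {ρ : Measure ℝ} [IsFiniteMeasure ρ] {κ : ℝ} (hκ : 0 < κ)
    (hexp : Integrable (fun x : ℝ => Real.exp (|x| * κ)) ρ) :
    ∃ (Ω : Type) (_ : MeasurableSpace Ω) (P : Measure Ω) (_ : IsProbabilityMeasure P)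
      (f : Ω → ℂ → ℂ), (∀ ω, AnalyticOnNhd ℂ (f ω) (strip (κ / 2))) ∧
      (∀ ω, ∀ z, f ω (starRingEnd ℂ z) = starRingEnd ℂ (f ω z)) ∧
      HasHartleyLaw ρ (strip (κ / 2)) f P := by
  obtain ⟨Ω, mΩ, P, hP, η, hη, hlaw, hsum⟩ :=
    exists_gaussian_family_summable (fun q => bandLp ρ q) (coeffBound κ)
      (fun n q => by unfold coeffBound; positivity) (summable_coeffBound_mul hκ hexp)
  have hle : ∀ (n : ℕ) (z : ℂ), ‖z‖ < (n : ℝ) + 1 → |z.im| < κ / 2 - 1 / ((n : ℝ) + 1) →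
      ∀ q, ‖hartleyCoeff q z‖ ≤ coeffBound κ n q := fun n z h1 h2 q =>
    norm_hartleyCoeff_le q h1.le h2.le
  refine ⟨Ω, mΩ, P, hP, fun ω z => ∑' q, hartleyCoeff q z * (η q ω : ℂ), ?_, ?_, ?_⟩
  · intro ω
    refine DifferentiableOn.analyticOnNhd (fun z hz => ?_) (isOpen_strip _)
    obtain ⟨n, hn1, hn2⟩ := exists_nat_bound_of_mem_strip hz
    let V : Set ℂ := {w | ‖w‖ < (n : ℝ) + 1} ∩ {w | |w.im| < κ / 2 - 1 / ((n : ℝ) + 1)}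
    have hV : IsOpen V := (isOpen_lt continuous_norm continuous_const).inter (isOpen_strip _)
    refine ((Complex.differentiableOn_tsum_of_summable_norm (U := V) (hsum ω n) (fun q => ?_) hV
      fun q w hw => ?_).differentiableAt (hV.mem_nhds ⟨hn1, hn2⟩)).differentiableWithinAt
    · exact ((differentiable_hartleyCoeff q).mul_const _).differentiableOn
    · rw [norm_mul, Complex.norm_real, Real.norm_eq_abs]
      exact mul_le_mul_of_nonneg_right (hle n w hw.1 hw.2 q) (abs_nonneg _)
  -- No restriction to the strip is needed: conjugation commutes with `tsum` even when the series
  -- diverges and the sum is zero by convention.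
  · intro ω z
    rw [Complex.conj_tsum]
    simp [hartleyCoeff_conj]
  · intro T _ p c hp
    have hS : ∀ t ω, Summable fun q => hartleyCoeff q (p t) * (η q ω : ℂ) := by
      intro t ω
      obtain ⟨n, hn1, hn2⟩ := exists_nat_bound_of_mem_strip (hp t)
      refine Summable.of_norm_bounded (hsum ω n) fun q => ?_
      rw [norm_mul, Complex.norm_real, Real.norm_eq_abs]
      exact mul_le_mul_of_nonneg_right (hle n _ hn1 hn2 q) (abs_nonneg _)
    have hre : ∀ (q : ℤ × ℕ) (y : ℝ), (∑ t, c t * hartleyCoeff q (p t)).re * y =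
        (∑ t, c t * (hartleyCoeff q (p t) * (y : ℂ))).re := by
      intro q y
      simp_rw [← mul_assoc]
      rw [← Finset.sum_mul, Complex.re_mul_ofReal]
    refine map_eq_gaussianReal_of_hasSum hη hlaw
      (b := fun q => (∑ t, c t * hartleyCoeff q (p t)).re) ?_ ?_ ?_
    · have hmain : Summable fun q : ℤ × ℕ =>
          ∑ t, ‖c t‖ * (‖hartleyCoeff q (p t)‖ * ‖bandLp ρ q‖) := by
        refine summable_sum fun t _ => Summable.mul_left _ ?_
        obtain ⟨n, hn1, hn2⟩ := exists_nat_bound_of_mem_strip (hp t)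
        exact Summable.of_nonneg_of_le (fun q => by positivity)
          (fun q => mul_le_mul_of_nonneg_right (hle n _ hn1 hn2 q) (norm_nonneg _))
          (summable_coeffBound_mul hκ hexp n)
      refine Summable.of_nonneg_of_le (fun q => by positivity) (fun q => ?_) hmain
      simp_rw [← mul_assoc]
      rw [← Finset.sum_mul]
      refine mul_le_mul_of_nonneg_right ?_ (norm_nonneg _)
      refine (Complex.abs_re_le_norm _).trans ((norm_sum_le _ _).trans (le_of_eq ?_))
      simp
    · intro ω
      simp_rw [hre]
      exact Complex.hasSum_re (hasSum_sum fun t _ => (hS t ω).hasSum.mul_left _)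
    · have hc : ∀ᵐ x ∂ρ, ∀ q, bandLp ρ q x = bandPow q x :=
        ae_all_iff.2 fun q => (memLp_bandPow ρ q).coeFn_toLp
      filter_upwards [hc] with x hx
      simp_rw [hx, hre]
      exact Complex.hasSum_re (hasSum_sum fun t _ => (hasSum_hartleyCoeff x (p t)).mul_left _)

/-! ### Symmetry of the spectral measure and its consequences -/

/-- Reflecting `ρ` conjugates its characteristic function, which is real here. -/
lemma map_neg_eq_self_of_covExt_real {ρ : Measure ℝ} [IsFiniteMeasure ρ]
    (h : ∀ t : ℝ, ∃ c : ℝ, covExt ρ t = c) : ρ.map Neg.neg = ρ := by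
  apply Measure.ext_of_charFun
  ext t
  have h1 : ∀ t : ℝ, charFun ρ t = covExt ρ ((-t : ℝ) : ℂ) := fun t => by
    rw [charFun_apply_real, covExt]
    congr 1
    ext x
    push_cast
    ring_nf
  have h2 := charFun_map_mul (μ := ρ) (-1) t
  have h3 : (fun x : ℝ => -1 * x) = Neg.neg := by ext; simp
  rw [h3, neg_one_mul, charFun_neg] at h2
  obtain ⟨c, hc⟩ := h (-t)
  rw [h2, h1, hc, Complex.conj_ofReal]

/-- Integrability plays no role, since the change of variables is an equivalence and a nonintegrable
function has integral zero. -/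
lemma integral_eq_zero_of_odd {ρ : Measure ℝ} (hρ : ρ.map Neg.neg = ρ) {E : Type*}
    [NormedAddCommGroup E] [NormedSpace ℝ E] {g : ℝ → E} (hg : ∀ x, g (-x) = -g x) :
    ∫ x, g x ∂ρ = 0 := by
  have h := integral_map_equiv (μ := ρ) (MeasurableEquiv.neg ℝ) g
  have h2 : ρ.map (MeasurableEquiv.neg ℝ) = ρ := hρ
  rw [h2] at h
  simp only [MeasurableEquiv.neg_apply, hg, integral_neg] at h
  have h3 : (2 : ℝ) • ∫ x, g x ∂ρ = 0 := by
    rw [two_smul]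
    nth_rewrite 1 [h]
    exact neg_add_cancel _
  exact (smul_eq_zero.1 h3).resolve_left two_ne_zero

lemma continuous_hartley : Continuous hartley := by
  unfold hartley; fun_prop

lemma integrable_hartley_mul_hartley {ρ : Measure ℝ} {κ : ℝ}
    (hexp : Integrable (fun x : ℝ => Real.exp (|x| * κ)) ρ) {z w : ℂ}
    (hz : z ∈ strip (κ / 2)) (hw : w ∈ strip (κ / 2)) :
    Integrable (fun x : ℝ => hartley (x * z) * hartley (x * w)) ρ := by
  have := continuous_hartley
  refine (hexp.const_mul 4).mono' (by fun_prop) (Filter.Eventually.of_forall fun x => ?_)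
  rw [norm_mul]
  have hz' : |z.im| < κ / 2 := hz
  have hw' : |w.im| < κ / 2 := hw
  calc ‖hartley (x * z)‖ * ‖hartley (x * w)‖
      ≤ (2 * Real.exp (|x| * |z.im|)) * (2 * Real.exp (|x| * |w.im|)) := by
        gcongr <;> exact norm_hartley_le _ _
    _ = 4 * Real.exp (|x| * (|z.im| + |w.im|)) := by rw [mul_add, Real.exp_add]; ring
    _ ≤ 4 * Real.exp (|x| * κ) := by gcongr; linarith

lemma integral_hartley_mul_hartley {ρ : Measure ℝ} (hρ : ρ.map Neg.neg = ρ) {κ : ℝ}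
    (hexp : Integrable (fun x : ℝ => Real.exp (|x| * κ)) ρ) {z w : ℂ}
    (hz : z ∈ strip (κ / 2)) (hw : w ∈ strip (κ / 2)) :
    ∫ x : ℝ, hartley (x * z) * hartley (x * w) ∂ρ = covExt ρ (z - w) := by
  have hint : Integrable (fun x : ℝ => Complex.exp (-Complex.I * x * (z - w))) ρ := by
    refine hexp.mono' (by fun_prop) (Filter.Eventually.of_forall fun x => ?_)
    rw [mul_assoc]
    refine (norm_exp_neg_I_mul_ofReal_mul_le x (z - w)).trans ?_
    have hz' : |z.im| < κ / 2 := hz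
    have hw' : |w.im| < κ / 2 := hw
    have := abs_sub z.im w.im
    rw [Complex.sub_im]
    gcongr
    linarith
  rw [covExt, ← sub_eq_zero, ← integral_sub (integrable_hartley_mul_hartley hexp hz hw) hint]
  refine integral_eq_zero_of_odd hρ ?_
  -- The difference between the product of kernels and the exponential is a combination of sines,
  -- hence odd in `x`.
  have key : ∀ x : ℂ, hartley (x * z) * hartley (x * w) - Complex.exp (-Complex.I * x * (z - w)) =
      Complex.sin (x * (z + w)) + Complex.I * Complex.sin (x * (z - w)) := by
    intro x
    rw [show -Complex.I * x * (z - w) = (-(x * (z - w))) * Complex.I by ring, Complex.exp_mul_I,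
      Complex.cos_neg, Complex.sin_neg, mul_sub, mul_add, Complex.cos_sub, Complex.sin_add]
    unfold hartley
    ring
  intro x
  rw [key, key]
  push_cast
  rw [neg_mul, neg_mul, Complex.sin_neg, Complex.sin_neg]
  ring

lemma hartley_ofReal_re (x t : ℝ) : (((hartley (x * t)).re : ℝ) : ℂ) = hartley (x * t) := by
  rw [hartley, ← Complex.ofReal_mul, ← Complex.ofReal_cos, ← Complex.ofReal_sin,
    ← Complex.ofReal_add, Complex.ofReal_re]

lemma hartley_mul_add (x t z : ℂ) : hartley (x * (z + t)) =
    Complex.cos (x * t) * hartley (x * z) + Complex.sin (x * t) * hartley (-x * z) := by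
  rw [mul_add, hartley, hartley, hartley, Complex.cos_add, Complex.sin_add, neg_mul,
    Complex.cos_neg, Complex.sin_neg]
  ring

/-- The variance in `HasHartleyLaw` is invariant under real translations. -/
lemma integral_sq_hartley_translate {ρ : Measure ℝ} (hρ : ρ.map Neg.neg = ρ) {T : Type*}
    [Fintype T] (p c : T → ℂ) (τ : ℝ)
    (h0 : MemLp (fun x : ℝ => (∑ t, c t * hartley (x * p t)).re) 2 ρ)
    (hτ : MemLp (fun x : ℝ => (∑ t, c t * hartley (x * (p t + τ))).re) 2 ρ) :
    ∫ x : ℝ, (∑ t, c t * hartley (x * (p t + τ))).re ^ 2 ∂ρ =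
      ∫ x : ℝ, (∑ t, c t * hartley (x * p t)).re ^ 2 ∂ρ := by
  rw [← sub_eq_zero, ← integral_sub hτ.integrable_sq h0.integrable_sq]
  refine integral_eq_zero_of_odd hρ ?_
  set g : ℝ → ℝ := fun x => (∑ t, c t * hartley (x * p t)).re with hg
  -- A translation by `τ` acts on the pair `(g x, g (-x))` as a rotation by the angle `x * τ`. It
  -- therefore preserves `g x ^ 2 + g (-x) ^ 2`, so the change in the square is odd.
  have key : ∀ x : ℝ, (∑ t, c t * hartley (x * (p t + τ))).re =
      Real.cos (x * τ) * g x + Real.sin (x * τ) * g (-x) := by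
    intro x
    simp only [hg]
    rw [← Complex.re_ofReal_mul, ← Complex.re_ofReal_mul, ← Complex.add_re, Finset.mul_sum,
      Finset.mul_sum, ← Finset.sum_add_distrib]
    congr 1
    refine Finset.sum_congr rfl fun t _ => ?_
    rw [hartley_mul_add]
    push_cast
    ring
  intro x
  simp only [key, neg_neg, neg_mul, Real.cos_neg, Real.sin_neg]
  linear_combination (g x ^ 2 + g (-x) ^ 2) * Real.sin_sq_add_cos_sq (x * τ)

/-! ### Laws and moments from real parts of complex combinations -/

lemma exists_re_sum_eq_of_strongDual {T : Type*} [Fintype T] (L : (T → ℂ) →L[ℝ] ℝ) :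
    ∃ c : T → ℂ, ∀ x, L x = (∑ t, c t * x t).re := by
  classical
  refine ⟨fun t => ⟨L (Pi.single t 1), -L (Pi.single t Complex.I)⟩, fun x => ?_⟩
  have hx : x = ∑ t, ((x t).re • (Pi.single t 1 : T → ℂ) +
      (x t).im • (Pi.single t Complex.I : T → ℂ)) := by
    ext t
    simp [Finset.sum_apply, Pi.single_apply, Finset.sum_add_distrib, Complex.re_add_im]
  conv_lhs => rw [hx]
  simp only [map_sum, map_add, map_smul, smul_eq_mul, Complex.re_sum, Complex.mul_re]
  exact Finset.sum_congr rfl fun t _ => by ring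

/-- Two complex processes are identically distributed as soon as the real parts of the finite
complex linear combinations of their values are. -/
theorem identDistrib_of_map_re_sum_eq {T Ω Ω' : Type*} [MeasurableSpace Ω] [MeasurableSpace Ω']
    {P : Measure Ω} {P' : Measure Ω'} [IsProbabilityMeasure P] [IsProbabilityMeasure P']
    {Y : T → Ω → ℂ} {Y' : T → Ω' → ℂ} (hY : ∀ t, Measurable (Y t)) (hY' : ∀ t, Measurable (Y' t))
    (h : ∀ (s : Finset T) (c : s → ℂ), P.map (fun ω => (∑ t, c t * Y t ω).re) =
      P'.map (fun ω => (∑ t, c t * Y' t ω).re)) :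
    IdentDistrib (fun ω t => Y t ω) (fun ω t => Y' t ω) P P' := by
  have hm : Measurable fun ω t => Y t ω := measurable_pi_lambda _ hY
  have hm' : Measurable fun ω t => Y' t ω := measurable_pi_lambda _ hY'
  refine ⟨hm.aemeasurable, hm'.aemeasurable, ?_⟩
  have e : (fun s : Finset T => P.map (fun ω => s.restrict (Y · ω))) =
      fun s : Finset T => P'.map (fun ω => s.restrict (Y' · ω)) := by
    ext1 s
    have hs : Measurable fun ω => s.restrict (Y · ω) := measurable_pi_lambda _ fun t => hY t
    have hs' : Measurable fun ω => s.restrict (Y' · ω) := measurable_pi_lambda _ fun t => hY' t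
    have := Measure.isProbabilityMeasure_map hs.aemeasurable (μ := P)
    have := Measure.isProbabilityMeasure_map hs'.aemeasurable (μ := P')
    apply Measure.ext_of_charFunDual
    ext L
    obtain ⟨c, hc⟩ := exists_re_sum_eq_of_strongDual L
    rw [charFunDual_eq_charFun_map_one, charFunDual_eq_charFun_map_one,
      Measure.map_map L.continuous.measurable hs, Measure.map_map L.continuous.measurable hs']
    have := h s c
    simp only [Function.comp_def, hc]
    simpa using congrArg (charFun · 1) this
  -- Both laws are projective limits of the same finite-dimensional distributions, and such a limit
  -- is unique.
  have h1 := isProjectiveLimit_map (P := P) (X := Y) hm.aemeasurable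
  have h2 := isProjectiveLimit_map (P := P') (X := Y') hm'.aemeasurable
  rw [e] at h1
  exact h1.unique h2

lemma integral_mul_of_forall_re_mul_re {α β : Type*} [MeasurableSpace α] [MeasurableSpace β]
    {μ : Measure α} {ν : Measure β} {φ ψ : α → ℂ} {Φ Ψ : β → ℂ}
    (hα : ∀ c d : ℂ, Integrable (fun x => (c * φ x).re * (d * ψ x).re) μ)
    (hβ : ∀ c d : ℂ, Integrable (fun x => (c * Φ x).re * (d * Ψ x).re) ν)
    (h : ∀ c d : ℂ, ∫ x, (c * φ x).re * (d * ψ x).re ∂μ = ∫ x, (c * Φ x).re * (d * Ψ x).re ∂ν) :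
    Integrable (fun x => φ x * ψ x) μ ∧ ∫ x, φ x * ψ x ∂μ = ∫ x, Φ x * Ψ x ∂ν := by
  -- The real part of `-i u` is the imaginary part of `u`, so `c, d ∈ {1, -i}` recover the whole
  -- complex product.
  have key : ∀ u v : ℂ, u * v =
      (((1 * u).re * (1 * v).re - (-Complex.I * u).re * (-Complex.I * v).re : ℝ) : ℂ) +
      (((1 * u).re * (-Complex.I * v).re + (-Complex.I * u).re * (1 * v).re : ℝ) : ℂ) *
        Complex.I := by
    intro u v
    apply Complex.ext <;> simp
  have hα1 := (hα 1 1).sub (hα (-Complex.I) (-Complex.I))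
  have hα2 := (hα 1 (-Complex.I)).add (hα (-Complex.I) 1)
  have hβ1 := (hβ 1 1).sub (hβ (-Complex.I) (-Complex.I))
  have hβ2 := (hβ 1 (-Complex.I)).add (hβ (-Complex.I) 1)
  simp_rw [fun x => key (φ x) (ψ x), fun x => key (Φ x) (Ψ x)]
  refine ⟨hα1.ofReal.add (hα2.ofReal.mul_const _), ?_⟩
  rw [integral_add (hα1.ofReal) (hα2.ofReal.mul_const _),
    integral_add (hβ1.ofReal) (hβ2.ofReal.mul_const _), integral_mul_const, integral_mul_const,
    integral_complex_ofReal, integral_complex_ofReal, integral_complex_ofReal,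
    integral_complex_ofReal, integral_sub (hα _ _) (hα _ _), integral_add (hα _ _) (hα _ _),
    integral_sub (hβ _ _) (hβ _ _), integral_add (hβ _ _) (hβ _ _)]
  simp only [h]

lemma integral_sq_sum {α T : Type*} [Fintype T] [MeasurableSpace α] {μ : Measure α}
    {U : T → α → ℝ} (hU : ∀ t, MemLp (U t) 2 μ) (a : T → ℝ) :
    ∫ x, (∑ t, a t * U t x) ^ 2 ∂μ = ∑ s, ∑ t, a s * a t * ∫ x, U s x * U t x ∂μ := by
  have hi : ∀ s t, Integrable (fun x => a s * a t * (U s x * U t x)) μ := fun s t =>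
    ((hU s).integrable_mul (hU t)).const_mul _
  have e : ∀ x, (∑ t, a t * U t x) ^ 2 = ∑ s, ∑ t, a s * a t * (U s x * U t x) := fun x => by
    rw [sq, Finset.sum_mul_sum]
    exact Finset.sum_congr rfl fun s _ => Finset.sum_congr rfl fun t _ => by ring
  simp_rw [e]
  rw [integral_finsetSum _ fun s _ => integrable_finsetSum _ fun t _ => hi s t]
  refine Finset.sum_congr rfl fun s _ => ?_
  rw [integral_finsetSum _ fun t _ => hi s t]
  simp_rw [integral_const_mul]

/-! ### Moments and Gaussianity of the constructed function -/

namespace HasHartleyLaw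

variable {Ω : Type*} [MeasurableSpace Ω] {ρ : Measure ℝ} {U : Set ℂ} {f : Ω → ℂ → ℂ}
  {P : Measure Ω}

lemma re_const_mul (hf : HasHartleyLaw ρ U f P) {z : ℂ} (hz : z ∈ U) (c : ℂ) :
    Measurable (fun ω => (c * f ω z).re) ∧ MemLp (fun ω => (c * f ω z).re) 2 P ∧
    ∫ ω, (c * f ω z).re ∂P = 0 ∧ MemLp (fun x : ℝ => (c * hartley (x * z)).re) 2 ρ ∧
    ∫ ω, (c * f ω z).re ^ 2 ∂P = ∫ x : ℝ, (c * hartley (x * z)).re ^ 2 ∂ρ := by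
  obtain ⟨h1, h2, h3⟩ := hf (T := Unit) (fun _ => z) (fun _ => c) fun _ => hz
  obtain ⟨h4, h5, h6⟩ := integral_sq_of_map_eq_gaussianReal h1 h3
  rw [Real.coe_toNNReal _ (integral_nonneg fun x => sq_nonneg _)] at h6
  simp only [Finset.univ_unique, Finset.sum_singleton] at h1 h2 h4 h5 h6
  exact ⟨h1, h4, h5, h2, h6⟩

lemma measurable (hf : HasHartleyLaw ρ U f P) {z : ℂ} (hz : z ∈ U) :
    Measurable fun ω => f ω z := by
  have h1 := (hf.re_const_mul hz 1).1
  have h2 := (hf.re_const_mul hz (-Complex.I)).1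
  have : (fun ω => f ω z) = fun ω =>
      (((1 * f ω z).re : ℝ) : ℂ) + (((-Complex.I * f ω z).re : ℝ) : ℂ) * Complex.I := by
    funext ω
    apply Complex.ext <;> simp
  rw [this]
  fun_prop

lemma integral_eq_zero (hf : HasHartleyLaw ρ U f P) [IsProbabilityMeasure P] {z : ℂ}
    (hz : z ∈ U) : ∫ ω, f ω z ∂P = 0 := by
  obtain ⟨-, h1, h1', -⟩ := hf.re_const_mul hz 1
  obtain ⟨-, h2, h2', -⟩ := hf.re_const_mul hz (-Complex.I)
  have : (fun ω => f ω z) = fun ω =>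
      (((1 * f ω z).re : ℝ) : ℂ) + (((-Complex.I * f ω z).re : ℝ) : ℂ) * Complex.I := by
    funext ω
    apply Complex.ext <;> simp
  rw [this, integral_add (h1.integrable one_le_two).ofReal
    ((h2.integrable one_le_two).ofReal.mul_const _), integral_mul_const, integral_complex_ofReal,
    integral_complex_ofReal, h1', h2']
  simp

lemma integral_mul (hf : HasHartleyLaw ρ U f P) {z w : ℂ} (hz : z ∈ U) (hw : w ∈ U) :
    Integrable (fun ω => f ω z * f ω w) P ∧
      ∫ ω, f ω z * f ω w ∂P = ∫ x : ℝ, hartley (x * z) * hartley (x * w) ∂ρ := by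
  refine integral_mul_of_forall_re_mul_re (fun c d => ?_) (fun c d => ?_) (fun c d => ?_)
  · exact (hf.re_const_mul hz c).2.1.integrable_mul (hf.re_const_mul hw d).2.1
  · exact (hf.re_const_mul hz c).2.2.2.1.integrable_mul (hf.re_const_mul hw d).2.2.2.1
  · obtain ⟨-, a1, -, a2, a3⟩ := hf.re_const_mul hz c
    obtain ⟨-, b1, -, b2, b3⟩ := hf.re_const_mul hw d
    obtain ⟨h1, h2, h3⟩ := hf (T := Bool) (fun i => bif i then z else w)
      (fun i => bif i then c else d) (by rintro (_ | _) <;> simpa)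
    obtain ⟨h4, -, h6⟩ := integral_sq_of_map_eq_gaussianReal h1 h3
    rw [Real.coe_toNNReal _ (integral_nonneg fun x => sq_nonneg _)] at h6
    simp only [Fintype.sum_bool, cond_true, cond_false, Complex.add_re] at h2 h4 h6
    -- Polarization: the two-point combination gives the second moment of the sum, from which the
    -- mixed moment follows.
    have pol : ∀ x y : ℝ, x * y = 2⁻¹ * ((x + y) ^ 2 - x ^ 2 - y ^ 2) := fun x y => by ring
    simp_rw [fun ω => pol (c * f ω z).re (d * f ω w).re,
      fun x : ℝ => pol (c * hartley (x * z)).re (d * hartley (x * w)).re]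
    rw [integral_const_mul, integral_const_mul, integral_sub _ b1.integrable_sq,
      integral_sub h4.integrable_sq a1.integrable_sq, integral_sub _ b2.integrable_sq,
      integral_sub h2.integrable_sq a2.integrable_sq, a3, b3, h6]
    · exact h2.integrable_sq.sub a2.integrable_sq
    · exact h4.integrable_sq.sub a1.integrable_sq

lemma isGaussianProcess (hf : HasHartleyLaw ρ U f P) :
    IsGaussianProcess (fun (z : U) ω => f ω z) P := by
  refine ⟨fun I => ⟨isGaussian_of_map_eq_gaussianReal fun L => ?_⟩⟩
  obtain ⟨c, hc⟩ := exists_re_sum_eq_of_strongDual L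
  obtain ⟨-, -, h⟩ := hf (T := I) (fun z => z) c fun z => z.1.2
  refine ⟨_, _, Eq.trans ?_ h⟩
  refine (Measure.map_map L.continuous.measurable
    (measurable_pi_lambda _ fun z => hf.measurable z.1.2)).trans ?_
  simp [Function.comp_def, hc]

end HasHartleyLaw

/-! ### The given process in terms of the Hartley kernel -/

namespace IsStationaryGaussian

variable {Ω : Type*} [MeasurableSpace Ω] {P : Measure Ω} {X : ℝ → Ω → ℝ}

lemma memLp_two (hX : IsStationaryGaussian X P) (t : ℝ) : MemLp (X t) 2 P :=
  (hX.gaussian.hasGaussianLaw_eval t).memLp_two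

lemma integral_mul [IsProbabilityMeasure P] (hX : IsStationaryGaussian X P) (s t : ℝ) :
    ∫ ω, X s ω * X t ω ∂P = cov[X (s - t), X 0; P] := by
  have h := ((hX.stationary t).comp (u := fun g : ℝ → ℝ => g (s - t) * g 0)
    (by fun_prop)).integral_eq
  rw [covariance_eq_sub (hX.memLp_two _) (hX.memLp_two _), hX.centered, hX.centered]
  simpa [Function.comp_def] using h

/-- The real parts of the complex linear combinations of values of a stationary Gaussian process
have the law prescribed by its spectral measure. -/
lemma map_re_sum [IsProbabilityMeasure P] (hX : IsStationaryGaussian X P) {ρ : Measure ℝ}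
    (hρ : IsSpectralMeasure X P ρ) (hsym : ρ.map Neg.neg = ρ) {κ : ℝ} (hκ : 0 < κ)
    (hexp : Integrable (fun x : ℝ => Real.exp (|x| * κ)) ρ) (s : Finset ℝ) (c : s → ℂ) :
    P.map (fun ω => (∑ t, c t * ((X t ω : ℝ) : ℂ)).re) =
      gaussianReal 0 (∫ x : ℝ, (∑ t, c t * hartley (x * ((t : ℝ) : ℂ))).re ^ 2 ∂ρ).toNNReal := by
  have := hρ.finite
  have hstrip : ∀ t : ℝ, (t : ℂ) ∈ strip (κ / 2) := fun t => by
    simpa [strip] using hκ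
  have e1 : (fun ω => (∑ t, c t * ((X t ω : ℝ) : ℂ)).re) = fun ω => ∑ t, (c t).re * X t ω := by
    funext ω
    simp [Complex.re_sum]
  have e2 : (fun x : ℝ => (∑ t, c t * hartley (x * ((t : ℝ) : ℂ))).re ^ 2) =
      fun x : ℝ => (∑ t, (c t).re * (hartley (x * ((t : ℝ) : ℂ))).re) ^ 2 := by
    funext x
    rw [Complex.re_sum]
    congr 1
    refine Finset.sum_congr rfl fun t _ => ?_
    rw [← hartley_ofReal_re, Complex.re_mul_ofReal, Complex.ofReal_re]
  have hG : HasGaussianLaw (fun ω => ∑ t, (c t).re * X t ω) P :=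
    ((hX.gaussian.comp_right (Subtype.val : s → ℝ)).smul fun t => (c t).re).hasGaussianLaw_fun_sum
      (I := Finset.univ)
  have hm : ∫ ω, ∑ t, (c t).re * X t ω ∂P = 0 := by
    rw [integral_finsetSum _ (f := fun (t : s) ω => (c t).re * X t ω)
      fun t _ => ((hX.memLp_two t).integrable one_le_two).const_mul _]
    simp [integral_const_mul, hX.centered]
  have hr : ∀ (t : ℝ), MemLp (fun x : ℝ => (hartley (x * (t : ℂ))).re) 2 ρ := by
    intro t
    have hc := continuous_hartley
    refine MemLp.of_bound (Continuous.aestronglyMeasurable (by fun_prop)) 2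
      (Filter.Eventually.of_forall fun x => (Complex.abs_re_le_norm _).trans ?_)
    simpa using norm_hartley_le x t
  have hcov : ∀ s t : ℝ, ∫ ω, X s ω * X t ω ∂P =
      ∫ x : ℝ, (hartley (x * (s : ℂ))).re * (hartley (x * (t : ℂ))).re ∂ρ := by
    intro s t
    rw [hX.integral_mul, ← Complex.ofReal_inj, hρ.cov_eq, Complex.ofReal_sub,
      ← integral_hartley_mul_hartley hsym hexp (hstrip s) (hstrip t), ← integral_complex_ofReal]
    simp_rw [Complex.ofReal_mul, hartley_ofReal_re]
  -- Both variances expand into quadratic forms in the real parts of `c`, with matrices that agree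
  -- by `hcov`.
  rw [e1, e2, hG.map_eq_gaussianReal, hm, variance_of_integral_eq_zero hG.aemeasurable hm,
    integral_sq_sum (U := fun (t : s) ω => X t ω) (fun t => hX.memLp_two t),
    integral_sq_sum (U := fun (t : s) (x : ℝ) => (hartley (x * ((t : ℝ) : ℂ))).re) (fun t => hr t)]
  simp_rw [hcov]

end IsStationaryGaussian
end

/-! ### The main theorem -/

theorem propositiont {Ω : Type*} [MeasurableSpace Ω] (P : Measure Ω) [IsProbabilityMeasure P]
    (X : ℝ → Ω → ℝ) (hX : IsStationaryGaussian X P)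
    (ρ : Measure ℝ) (hρ : IsSpectralMeasure X P ρ)
    (κ : ℝ) (hκ : 0 < κ) (hexp : Integrable (fun x : ℝ => Real.exp (|x| * κ)) ρ) :
    ∃ (Ω' : Type) (_ : MeasurableSpace Ω') (P' : Measure Ω') (_ : IsProbabilityMeasure P')
      (f : Ω' → ℂ → ℂ),
      IsGaussianAnalyticFunction (strip (κ / 2)) f P' ∧
      -- conjugation equivariance
      (∀ ω, ∀ z ∈ strip (κ / 2), f ω (starRingEnd ℂ z) = starRingEnd ℂ (f ω z)) ∧
      -- covariances
      (∀ z ∈ strip (κ / 2), ∀ w ∈ strip (κ / 2),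
        Integrable (fun ω => f ω z * starRingEnd ℂ (f ω w)) P' ∧
        ∫ ω, f ω z * starRingEnd ℂ (f ω w) ∂P' = covExt ρ (z - starRingEnd ℂ w) ∧
        Integrable (fun ω => f ω z * f ω w) P' ∧
        ∫ ω, f ω z * f ω w ∂P' = covExt ρ (z - w)) ∧
      -- stationarity under real translations
      (∀ t : ℝ, IdentDistrib
        (fun ω (z : strip (κ / 2)) => f ω ((z : ℂ) + (t : ℂ)))
        (fun ω (z : strip (κ / 2)) => f ω (z : ℂ)) P' P') ∧
      -- the restriction to the real line has the law of the original process
      IdentDistrib (fun ω (t : ℝ) => f ω (t : ℂ)) (fun ω (t : ℝ) => ((X t ω : ℝ) : ℂ)) P' P := by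
  have := hρ.finite
  have hsym : ρ.map Neg.neg = ρ :=
    map_neg_eq_self_of_covExt_real fun t => ⟨_, (hρ.cov_eq t).symm⟩
  obtain ⟨Ω', mΩ', P', hP', f, hfa, hfc, hf⟩ := exists_analytic_hasHartleyLaw hκ hexp
  have hstrip : ∀ t : ℝ, (t : ℂ) ∈ strip (κ / 2) := fun t => by
    simpa [strip] using hκ
  have hadd : ∀ (t : ℝ) (z : strip (κ / 2)), (z : ℂ) + (t : ℂ) ∈ strip (κ / 2) := fun t z => by
    simpa [strip] using z.2
  have hconj : ∀ z ∈ strip (κ / 2), starRingEnd ℂ z ∈ strip (κ / 2) := fun z hz => by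
    simpa [strip] using hz
  refine ⟨Ω', mΩ', P', hP', f, ⟨fun z hz => hf.measurable hz, hfa, hf.isGaussianProcess,
    fun z hz => hf.integral_eq_zero hz⟩, fun ω z _ => hfc ω z, ?_, ?_, ?_⟩
  · intro z hz w hw
    -- The Hermitian covariance is the plain one at the conjugate of `w`, rewritten by equivariance.
    obtain ⟨h1, h2⟩ := hf.integral_mul hz (hconj w hw)
    obtain ⟨h3, h4⟩ := hf.integral_mul hz hw
    rw [integral_hartley_mul_hartley hsym hexp hz (hconj w hw)] at h2
    rw [integral_hartley_mul_hartley hsym hexp hz hw] at h4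
    simp only [hfc] at h1 h2
    exact ⟨h1, h2, h3, h4⟩
  · intro t
    refine identDistrib_of_map_re_sum_eq (Y := fun (z : strip (κ / 2)) ω => f ω ((z : ℂ) + (t : ℂ)))
      (Y' := fun (z : strip (κ / 2)) ω => f ω (z : ℂ))
      (fun z => hf.measurable (hadd t z)) (fun z => hf.measurable z.2) fun s c => ?_
    obtain ⟨-, h1, h2⟩ := hf (T := s) (fun z => (z : ℂ) + (t : ℂ)) c fun z => hadd t z
    obtain ⟨-, h3, h4⟩ := hf (T := s) (fun z => (z : ℂ)) c fun z => z.1.2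
    rw [h2, h4, integral_sq_hartley_translate hsym _ c t h3 h1]
  · refine identDistrib_of_map_re_sum_eq (Y := fun (t : ℝ) ω => f ω (t : ℂ))
      (Y' := fun (t : ℝ) ω => ((X t ω : ℝ) : ℂ)) (fun t => hf.measurable (hstrip t))
      (fun t => (hX.measurable t).complex_ofReal) fun s c => ?_
    obtain ⟨-, -, h⟩ := hf (T := s) (fun t => ((t : ℝ) : ℂ)) c fun t => hstrip t
    rw [h, hX.map_re_sum hρ hsym hκ hexp s c]
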